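/- Let $\Theta=\mathbb B^d$ be the closed Euclidean unit ball of $\mathbb R^d$, $d\ge 1$. In each round $t=1,\dots,T$ a learner plays $z_t\in\Theta$ and observes $y_t=f_t(z_t)+\xi_t$. The noise variables $\xi_t$ are independent with common law $F$, and for some $0<I_0<\infty$ and $0<v_0\le\infty$, $$\int \log\frac{dF(u)}{dF(u+v)}\,dF(u)\le I_0v^2\qquad\text{for all } |v|<v_0 ,$$ that is, the Kullback–Leibler divergence of $F$ from its translate by $v$ is at most $I_0v^2$. A randomized algorithm chooses $z_t=\Phi_t(u,z_1,y_1,\dots,z_{t-1},y_{t-1})\in\Theta$ with Borel maps $\Phi_t$ and a random seed $u$ (of any law, in any measurable space) that is independent of the noise. For $0<\alpha<\beta$ and $B>\alpha/4$ let $\mathcal F$ be the class of functions $f:\mathbb R^d\to\mathbb R$ that are $\alpha$-strongly convex (differentiable with $f(z)\ge f(x)+\langle\nabla f(x),z-x\rangle+\frac\alpha2\|z-x\|^2$ for all $x,z$) and $\beta$-smooth ($C^1$ with $\beta$-Lipschitz gradient), satisfy $|f|\le B$ on $\Theta$, and have their minimizer over $\mathbb R^d$ in $\Theta$. (With the normalization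 $B=1$ the condition on $\alpha$ is $\alpha<4$.) For an algorithm, put $$R^{\mathrm{dyn}}(T,\Delta,S)=\sup_{f_1,\dots,f_T}\ \sum_{t=1}^T\mathbb E\Big[f_t(z_t)-\min_{z\in\Theta}f_t(z)\Big],$$ where the supremum is over all $f_1,\dots,f_T\in\mathcal F$ such that $\sum_{t=2}^T\max_{z\in\Theta}|f_t(z)-f_{t-1}(z)|\le\Delta$ and $1+\sum_{t=2}^T\min\mathbf 1(z_t^*\ne z_{t-1}^*)\le S$, the inner minimum being over $z_t^*\in\arg\min_\Theta f_t$ and $z_{t-1}^*\in\arg\min_\Theta f_{t-1}$. Theorem. There is a constant $c>0$ that depends only on $\alpha,\beta,B,I_0,v_0$ such that for every such noise law $F$, all integers $d,T,S\ge1$, every real $\Delta\ge0$ and every randomized algorithm, $$R^{\mathrm{dyn}}(T,\Delta,S)\ \ge\ c\,\min\{T,\ d\sqrt{ST},\ d^{2/3}\Delta^{1/3}T^{2/3}\}.$$ In particular, whenever $T\ge T_0:=d^2\min(S,\Delta)$, $$R^{\mathrm{dyn}}(T,\Delta,S)\ \ge\ c\,\min\{d\sqrt{ST},\ d^{2/3}\Delta^{1/3}T^{2/3}\}.$$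 -/

import Mathlib

open MeasureTheory ProbabilityTheory InformationTheory
open scoped ENNReal RealInnerProductSpace Gradient

noncomputable section

namespace BanditLB

/-- The ambient Euclidean space of dimension `d`. -/
abbrev E (d : ℕ) : Type := EuclideanSpace ℝ (Fin d)

/-- The action set: the closed Euclidean unit ball. -/
def Ball (d : ℕ) : Set (E d) := Metric.closedBall 0 1

/-! ### Loss functions -/

/-- A differentiable function is `α`-strongly convex if it lies above its tangents by at least
`α / 2` times the squared distance. -/
def StronglyConvex {d : ℕ} (α : ℝ) (f : E d → ℝ) : Prop :=
  Differentiable ℝ f ∧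
    ∀ x z : E d, f x + ⟪∇ f x, z - x⟫ + α / 2 * ‖z - x‖ ^ 2 ≤ f z

/-- `β`-smoothness: continuously differentiable with `β`-Lipschitz gradient. -/
def Smooth {d : ℕ} (β : ℝ) (f : E d → ℝ) : Prop :=
  ContDiff ℝ 1 f ∧ ∀ x z : E d, ‖∇ f x - ∇ f z‖ ≤ β * ‖x - z‖

/-- The class of admissible losses: `α`-strongly convex and `β`-smooth on the whole space, bounded
by `B` in absolute value on the ball, with the global minimizer in the ball. -/
structure IsLoss {d : ℕ} (α β B : ℝ) (f : E d → ℝ) : Prop where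
  stronglyConvex : StronglyConvex α f
  smooth : Smooth β f
  bounded : ∀ x ∈ Ball d, |f x| ≤ B
  minimizer_mem : ∃ x ∈ Ball d, ∀ z, f x ≤ f z

/-! ### Non-stationarity of a loss sequence

Rounds are numbered from `0`, so the rounds of a game with horizon `T` are `0, …, T - 1`. -/

/-- The set of minimizers of `f` over the ball. -/
def argminSet {d : ℕ} (f : E d → ℝ) : Set (E d) :=
  {x | x ∈ Ball d ∧ ∀ z ∈ Ball d, f x ≤ f z}

open Classical in
/-- One plus the number of consecutive rounds whose minimizers have to differ: the smallest value
of the indicator of `x ≠ x'`, over minimizers `x` and `x'` of the two losses, is `0` exactly when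
the two sets of minimizers meet. -/
def numSwitches {d : ℕ} (T : ℕ) (f : ℕ → E d → ℝ) : ℕ :=
  1 + ∑ t ∈ Finset.range (T - 1),
    if (argminSet (f t) ∩ argminSet (f (t + 1))).Nonempty then 0 else 1

/-- Total variation: the sum over consecutive rounds of `max |f_{t+1} - f_t|` over the ball. -/
def totalVariation {d : ℕ} (T : ℕ) (f : ℕ → E d → ℝ) : ℝ :=
  ∑ t ∈ Finset.range (T - 1), sSup ((fun z => |f (t + 1) z - f t z|) '' Ball d)

/-- Environments with horizon `T`, total variation at most `Δ`, and at most `S` switches. -/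
structure IsEnvironment {d : ℕ} (α β B : ℝ) (T S : ℕ) (Δ : ℝ) (f : ℕ → E d → ℝ) : Prop where
  isLoss : ∀ t < T, IsLoss α β B (f t)
  totalVariation_le : totalVariation T f ≤ Δ
  numSwitches_le : numSwitches T f ≤ S

/-! ### Algorithms and their interaction with an environment -/

/-- A randomized algorithm: an internal random seed, drawn once and independently of the noise, and
for every round `t` a Borel map that sends the seed and the `t` past pairs (action, feedback) to
the next action, a point of the ball. -/
structure RandomizedAlgorithm (d : ℕ) (U : Type*) [MeasurableSpace U] where
  seedLaw : Measure U
  isProbabilityMeasure : IsProbabilityMeasure seedLaw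
  act : (t : ℕ) → U → (Fin t → E d × ℝ) → E d
  measurable_act : ∀ t, Measurable (fun p : U × (Fin t → E d × ℝ) => act t p.1 p.2)
  act_mem : ∀ t u H, act t u H ∈ Ball d

attribute [instance] RandomizedAlgorithm.isProbabilityMeasure

variable {d : ℕ} {U : Type*} [MeasurableSpace U]

/-- The pairs (action, feedback) of the first `t` rounds, for the seed `u` and the noise `ξ`: in
round `s` the algorithm plays `z` and observes `f s z + ξ s`. -/
def history (A : RandomizedAlgorithm d U) (f : ℕ → E d → ℝ) (u : U) (ξ : ℕ → ℝ) :
    (t : ℕ) → (Fin t → E d × ℝ)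
  | 0 => Fin.elim0
  | t + 1 =>
    let H := history A f u ξ t
    let z := A.act t u H
    Fin.snoc (α := fun _ => E d × ℝ) H (z, f t z + ξ t)

/-- The action played in round `t`. -/
def action (A : RandomizedAlgorithm d U) (f : ℕ → E d → ℝ) (u : U) (ξ : ℕ → ℝ) (t : ℕ) : E d :=
  A.act t u (history A f u ξ t)

/-- The expected dynamic regret over `T` rounds in the environment `f`, when the noise variables are
independent with law `F` and independent of the seed. -/
def regret (A : RandomizedAlgorithm d U) (F : Measure ℝ) [IsProbabilityMeasure F] (T : ℕ)
    (f : ℕ → E d → ℝ) : ℝ :=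
  ∑ t ∈ Finset.range T,
    ∫ ω : U × (ℕ → ℝ), (f t (action A f ω.1 ω.2 t) - sInf (f t '' Ball d))
      ∂(A.seedLaw.prod (Measure.infinitePi (fun _ : ℕ => F)))

/-- The worst-case dynamic regret: the supremum over all environments with horizon `T`, total
variation at most `Δ` and at most `S` switches, taken in the extended reals. -/
def dynRegret (A : RandomizedAlgorithm d U) (F : Measure ℝ) [IsProbabilityMeasure F]
    (α β B : ℝ) (T S : ℕ) (Δ : ℝ) : EReal :=
  ⨆ (f : ℕ → E d → ℝ) (_ : IsEnvironment α β B T S Δ f), ((regret A F T f : ℝ) : EReal)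

/-! ### Noise -/

/-- The Kullback–Leibler divergence of the noise law `F` from its translate `dF(u + v)` (the law of
`ξ - v` for `ξ` of law `F`) is at most `I₀ v²` for all `|v| < v₀`, where `v₀` may be infinite. -/
def KLCondition (F : Measure ℝ) (I₀ : ℝ) (v₀ : ℝ≥0∞) : Prop :=
  ∀ v : ℝ, ‖v‖ₑ < v₀ → klDiv F (F.map (fun u => u - v)) ≤ ENNReal.ofReal (I₀ * v ^ 2)

end BanditLB

end

/-! The hard losses are quadratics of curvature `a` with a sine ripple of amplitude `κ μ²` and
wavelength of order `μ` in every coordinate, each ripple carrying a sign. The second derivatives of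
the ripples are at most `κ` in absolute value whatever `μ` is, so for `α < a < min β (4B)` and small
`κ` all these losses are admissible. If `a y = κ cos y`, the signs move the minimizer to `(± y μ)ᵢ`.
By strong convexity, a coordinate of the action on the wrong side of zero costs a constant times
`μ²`. Reversing one sign, however, changes the loss by at most `2 κ μ²` at every point, so wherever
the learner plays, a round carries only `O(μ⁴)` of information about that sign.

If the signs stay fixed for `n` rounds and `n μ⁴` is a small constant, none of the `d` signs can be
identified, and each round costs a constant times `d μ²`. The choice `d μ² = θ min(1, d/√n)`, in
which the cap at `1` keeps the minimizers in the ball and the losses bounded, gives regret of order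
`T min(1, d/√n)` when independent signs are used on consecutive blocks of length `n`
(`exists_le_dynRegret_of_blockLength`). There are `(T - 1) / n` block boundaries, each costing at
most one switch and a variation of at most `d/√n`. The shortest blocks that fit both budgets have
length of order `max(1, T/S, (dT/Δ)^(2/3))`, and the three cases give the three terms of the minimum
(`exists_blockLength`).

The information argument (`integral_history_le`) never forms the law of a whole history. The
Donsker–Varadhan inequality `E_P h ≤ KL + log E_Q exp h` is applied to one observation at a time and
iterated by induction on the rounds, at a fixed seed. Applied to the indicator of guessing a sign
correctly, it shows that a learner who is right under one sign is often wrong under the other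
(`le_coordError_add`). Averaging over all sign patterns then yields one bad deterministic
environment. -/

namespace BanditLB

section

/-! ### Quadratic losses perturbed by sines -/

/-- The tangent inequality for the sine, up to a quadratic error. -/
theorem mul_sin_sub_sin_le {s : ℝ} (hs : |s| ≤ 1) (x y : ℝ) :
    s * (Real.sin y - Real.sin x - Real.cos x * (y - x)) ≤ (y - x) ^ 2 / 2 := by
  -- The cosine is 1-Lipschitz, so `g'(x) = x - s cos x` is monotone and `g` is convex; the claim is
  -- the tangent inequality for `g`.
  set g : ℝ → ℝ := fun x => x ^ 2 / 2 - s * Real.sin x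
  have hg : ∀ x, HasDerivAt g (x - s * Real.cos x) x := fun x => by
    have h := ((hasDerivAt_id x).pow 2).div_const 2
    refine (h.sub ((Real.hasDerivAt_sin x).const_mul s)).congr_deriv ?_
    simp
  have hmono : Monotone (deriv g) := by
    intro u v huv
    rw [(hg u).deriv, (hg v).deriv]
    have h1 := Real.abs_cos_sub_cos_le v u
    have h2 : s * (Real.cos v - Real.cos u) ≤ |v - u| := by
      refine (le_abs_self _).trans ?_
      rw [abs_mul]
      nlinarith [abs_nonneg (Real.cos v - Real.cos u)]
    rw [abs_of_nonneg (by linarith)] at h2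
    linarith
  have hconv : ConvexOn ℝ Set.univ g :=
    hmono.convexOn_univ_of_deriv fun x => (hg x).differentiableAt
  have key : (x - s * Real.cos x) * (y - x) ≤ g y - g x := by
    rcases lt_trichotomy x y with h | h | h
    · have := hconv.le_slope_of_hasDerivAt (Set.mem_univ x) (Set.mem_univ y) h (hg x)
      rwa [slope_def_field, le_div_iff₀ (by linarith)] at this
    · subst h; simp
    · have := hconv.slope_le_of_hasDerivAt (Set.mem_univ y) (Set.mem_univ x) h (hg x)
      rw [slope_def_field, div_le_iff₀ (by linarith)] at this
      linarith
  simp only [g] at key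
  nlinarith

/-- A quadratic with curvature `a`, perturbed in every coordinate by a sine wave of length `μ` and
amplitude `κ μ²`, with signs `s`. -/
noncomputable def loss {d : ℕ} (a κ μ : ℝ) (s : Fin d → ℝ) (z : E d) : ℝ :=
  a / 2 * ‖z‖ ^ 2 - a / 4 - κ * μ ^ 2 * ∑ i, s i * Real.sin (z i / μ)

/-- The gradient of `loss`. -/
noncomputable def lossGrad {d : ℕ} (a κ μ : ℝ) (s : Fin d → ℝ) (z : E d) : E d :=
  WithLp.toLp 2 fun i => a * z i - κ * μ * (s i * Real.cos (z i / μ))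

variable {d : ℕ} {a κ μ : ℝ} {s s' : Fin d → ℝ}

/-- The loss separates over the coordinates, so that curvature estimates reduce to one variable. -/
theorem loss_eq_sum (z : E d) : loss a κ μ s z =
    (∑ i, (a / 2 * z i ^ 2 - κ * μ ^ 2 * (s i * Real.sin (z i / μ)))) - a / 4 := by
  rw [loss, EuclideanSpace.real_norm_sq_eq, Finset.sum_sub_distrib, ← Finset.mul_sum,
    ← Finset.mul_sum]
  ring

theorem hasGradientAt_loss (hμ : μ ≠ 0) (z : E d) :
    HasGradientAt (loss a κ μ s) (lossGrad a κ μ s z) z := by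
  rw [hasGradientAt_iff_hasFDerivAt]
  have hc : ∀ i : Fin d, HasFDerivAt (fun z : E d => z i)
      (EuclideanSpace.proj i : E d →L[ℝ] ℝ) z := fun i =>
    (EuclideanSpace.proj i : E d →L[ℝ] ℝ).hasFDerivAt
  have h1 : ∀ i : Fin d, HasFDerivAt
      (fun z : E d => a / 2 * z i ^ 2 - κ * μ ^ 2 * (s i * Real.sin (z i / μ)))
      ((a * z i - κ * μ * (s i * Real.cos (z i / μ))) • (EuclideanSpace.proj i : E d →L[ℝ] ℝ))
      z := fun i => by
    have hg : HasDerivAt (fun x : ℝ => a / 2 * x ^ 2 - κ * μ ^ 2 * (s i * Real.sin (x / μ)))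
        (a * z i - κ * μ * (s i * Real.cos (z i / μ))) (z i) := by
      have h2 := ((hasDerivAt_id (z i)).pow 2).const_mul (a / 2)
      have h3 := ((((hasDerivAt_id (z i)).div_const μ).sin).const_mul (s i)).const_mul (κ * μ ^ 2)
      refine (h2.sub h3).congr_deriv ?_
      simp only [id]
      field_simp
      push_cast
      ring
    exact hg.comp_hasFDerivAt z (hc i)
  have h2 := (HasFDerivAt.fun_sum (u := Finset.univ) fun i _ => h1 i).sub_const (a / 4)
  have he : loss a κ μ s = fun z : E d =>
    (∑ i, (a / 2 * z i ^ 2 - κ * μ ^ 2 * (s i * Real.sin (z i / μ)))) - a / 4 :=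
    funext loss_eq_sum
  rw [he]
  refine h2.congr_fderiv ?_
  ext v
  simp [lossGrad, PiLp.inner_apply, mul_comm]

theorem gradient_loss (hμ : μ ≠ 0) (z : E d) :
    ∇ (loss a κ μ s) z = lossGrad a κ μ s z :=
  (hasGradientAt_loss hμ z).gradient

/-- Differentiating the sine twice cancels the factor `μ²`, so the ripple costs at most `κ` of
curvature at every scale. -/
theorem stronglyConvex_loss {α : ℝ} (hμ : μ ≠ 0) (hκ : 0 ≤ κ) (hs : ∀ i, |s i| ≤ 1)
    (hα : α ≤ a - κ) : StronglyConvex α (loss a κ μ s) := by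
  refine ⟨fun z => (hasGradientAt_loss hμ z).differentiableAt, fun x z => ?_⟩
  rw [gradient_loss hμ, loss_eq_sum, loss_eq_sum, PiLp.inner_apply, EuclideanSpace.real_norm_sq_eq,
    Finset.mul_sum, sub_add_eq_add_sub, sub_add_eq_add_sub, sub_le_sub_iff_right,
    ← Finset.sum_add_distrib, ← Finset.sum_add_distrib]
  refine Finset.sum_le_sum fun i _ => ?_
  have h := mul_sin_sub_sin_le (hs i) (x i / μ) (z i / μ)
  have h2 : κ * μ ^ 2 * (s i * (Real.sin (z i / μ) - Real.sin (x i / μ) -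
      Real.cos (x i / μ) * (z i / μ - x i / μ))) ≤ κ / 2 * (z i - x i) ^ 2 := by
    refine (mul_le_mul_of_nonneg_left h (by positivity)).trans (le_of_eq ?_)
    field_simp
  have h3 : κ * μ ^ 2 * (s i * (Real.cos (x i / μ) * (z i / μ - x i / μ))) =
      κ * μ * (s i * Real.cos (x i / μ)) * (z i - x i) := by
    field_simp
  simp only [lossGrad, PiLp.sub_apply, RCLike.inner_apply, conj_trivial]
  nlinarith [sq_nonneg (z i - x i)]

theorem contDiff_loss : ContDiff ℝ 1 (loss a κ μ s) := by
  unfold loss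
  have : ∀ i : Fin d, ContDiff ℝ 1 fun z : E d => z i := fun i =>
    (EuclideanSpace.proj i : E d →L[ℝ] ℝ).contDiff
  have h2 : ContDiff ℝ 1 fun z : E d => ‖z‖ ^ 2 := contDiff_norm_sq ℝ
  refine ((contDiff_const.mul h2).sub contDiff_const).sub (contDiff_const.mul ?_)
  exact ContDiff.sum fun i _ => contDiff_const.mul (((this i).div_const μ).sin)

theorem smooth_loss {β : ℝ} (hμ : 0 < μ) (ha : 0 ≤ a) (hκ : 0 ≤ κ) (hs : ∀ i, |s i| ≤ 1)
    (hβ : a + κ ≤ β) : Smooth β (loss a κ μ s) := by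
  refine ⟨contDiff_loss, fun x z => ?_⟩
  have hβ0 : 0 ≤ β := by linarith
  rw [gradient_loss hμ.ne', gradient_loss hμ.ne']
  refine abs_le_of_sq_le_sq' ?_ (by positivity) |>.2
  rw [mul_pow, EuclideanSpace.real_norm_sq_eq, EuclideanSpace.real_norm_sq_eq, Finset.mul_sum]
  refine Finset.sum_le_sum fun i _ => ?_
  rw [← mul_pow, sq_le_sq]
  have h1 : |κ * μ * (s i * (Real.cos (x i / μ) - Real.cos (z i / μ)))| ≤ κ * |x i - z i| := by
    rw [abs_mul, abs_mul (s i), abs_of_nonneg (by positivity : 0 ≤ κ * μ)]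
    have h2 := Real.abs_cos_sub_cos_le (x i / μ) (z i / μ)
    rw [← sub_div, abs_div, abs_of_pos hμ, le_div_iff₀ hμ] at h2
    have h3 : |s i| * |Real.cos (x i / μ) - Real.cos (z i / μ)| ≤
        |Real.cos (x i / μ) - Real.cos (z i / μ)| :=
      mul_le_of_le_one_left (abs_nonneg _) (hs i)
    calc _ ≤ κ * μ * |Real.cos (x i / μ) - Real.cos (z i / μ)| := by gcongr
      _ = κ * (|Real.cos (x i / μ) - Real.cos (z i / μ)| * μ) := by ring
      _ ≤ _ := by gcongr
  have h4 : (lossGrad a κ μ s x - lossGrad a κ μ s z) i =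
      a * (x i - z i) - κ * μ * (s i * (Real.cos (x i / μ) - Real.cos (z i / μ))) := by
    simp [lossGrad]; ring
  rw [h4]
  calc _ ≤ |a * (x i - z i)| + κ * |x i - z i| := (abs_sub _ _).trans (by gcongr)
    _ = (a + κ) * |x i - z i| := by rw [abs_mul, abs_of_nonneg ha]; ring
    _ ≤ |β * (x - z) i| := by
      rw [abs_mul, abs_of_nonneg hβ0]
      simp only [PiLp.sub_apply]
      gcongr

theorem abs_sum_mul_sin_le (hs : ∀ i, |s i| ≤ 1) (z : E d) :
    |∑ i, s i * Real.sin (z i / μ)| ≤ d := by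
  refine (Finset.abs_sum_le_sum_abs _ _).trans ?_
  calc _ ≤ ∑ _i : Fin d, (1 : ℝ) := Finset.sum_le_sum fun i _ => by
        rw [abs_mul]
        exact mul_le_one₀ (hs i) (abs_nonneg _) (Real.abs_sin_le_one _)
    _ = d := by simp

/-- The constant `-a/4` centres the quadratic part, whose range on the ball is then `[-a/4, a/4]`;
this is why `B > α/4` suffices. -/
theorem abs_loss_le {B : ℝ} (ha : 0 ≤ a) (hκ : 0 ≤ κ) (hs : ∀ i, |s i| ≤ 1)
    (hB : a / 4 + κ * (d * μ ^ 2) ≤ B) {z : E d} (hz : z ∈ Ball d) : |loss a κ μ s z| ≤ B := by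
  have h1 : ‖z‖ ≤ 1 := by simpa [Ball] using hz
  have h2 : ‖z‖ ^ 2 ≤ 1 := pow_le_one₀ (norm_nonneg _) h1
  have h3 : |κ * μ ^ 2 * ∑ i, s i * Real.sin (z i / μ)| ≤ κ * (d * μ ^ 2) := by
    rw [abs_mul, abs_of_nonneg (by positivity : 0 ≤ κ * μ ^ 2), mul_assoc, mul_comm (d : ℝ)]
    gcongr
    exact abs_sum_mul_sin_le hs z
  have h4 := abs_le.1 h3
  rw [loss, abs_le]
  constructor <;> nlinarith [sq_nonneg ‖z‖]

/-- The minimizer of `loss` when `a y = κ cos y`. -/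
noncomputable def lossMin {d : ℕ} (y μ : ℝ) (s : Fin d → ℝ) : E d :=
  WithLp.toLp 2 fun i => s i * (y * μ)

theorem norm_lossMin_sq {y : ℝ} (hs : ∀ i, s i = 1 ∨ s i = -1) :
    ‖lossMin y μ s‖ ^ 2 = d * (y * μ) ^ 2 := by
  rw [EuclideanSpace.real_norm_sq_eq]
  have : ∀ i, (lossMin y μ s) i ^ 2 = (y * μ) ^ 2 := fun i => by
    rcases hs i with h | h <;> simp [lossMin, h]
  simp [this]

theorem lossMin_mem_ball {y : ℝ} (hs : ∀ i, s i = 1 ∨ s i = -1) (h : d * (y * μ) ^ 2 ≤ 1) :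
    lossMin y μ s ∈ Ball d := by
  simp only [Ball, Metric.mem_closedBall, dist_zero_right]
  rw [← norm_lossMin_sq hs] at h
  exact (sq_le_one_iff₀ (norm_nonneg _)).1 h

/-- Since the cosine is even, the sign factors out of each partial derivative and leaves the single
equation `a y = κ cos y`. -/
theorem lossGrad_lossMin {y : ℝ} (hμ : μ ≠ 0) (hs : ∀ i, s i = 1 ∨ s i = -1)
    (hy : a * y = κ * Real.cos y) : lossGrad a κ μ s (lossMin y μ s) = 0 := by
  ext i
  simp only [lossGrad, lossMin, PiLp.zero_apply]
  rcases hs i with h | h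
  · rw [h, one_mul, mul_div_assoc, div_self hμ, mul_one, ← mul_assoc, hy]; ring
  · rw [h, neg_one_mul, neg_div, mul_div_assoc, div_self hμ, mul_one, Real.cos_neg]
    linear_combination -μ * hy

theorem add_norm_sq_le_loss {y α : ℝ} (hμ : μ ≠ 0) (hκ : 0 ≤ κ) (hs : ∀ i, s i = 1 ∨ s i = -1)
    (hy : a * y = κ * Real.cos y) (hα : α ≤ a - κ) (z : E d) :
    loss a κ μ s (lossMin y μ s) + α / 2 * ‖z - lossMin y μ s‖ ^ 2 ≤ loss a κ μ s z := by
  have h := (stronglyConvex_loss (s := s) (a := a) hμ hκ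
    (fun i => by rcases hs i with h | h <;> simp [h]) hα).2 (lossMin y μ s) z
  rw [gradient_loss hμ, lossGrad_lossMin hμ hs hy, inner_zero_left, add_zero] at h
  exact h

theorem isLoss_loss {y α β B : ℝ} (hμ : 0 < μ) (hκ : 0 ≤ κ) (hs : ∀ i, s i = 1 ∨ s i = -1)
    (hy : a * y = κ * Real.cos y) (hα0 : 0 ≤ α) (hα : α ≤ a - κ) (hβ : a + κ ≤ β)
    (hB : a / 4 + κ * (d * μ ^ 2) ≤ B) (hd : d * (y * μ) ^ 2 ≤ 1) :
    IsLoss α β B (loss a κ μ s) := by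
  have hs' : ∀ i, |s i| ≤ 1 := fun i => by rcases hs i with h | h <;> simp [h]
  refine ⟨stronglyConvex_loss hμ.ne' hκ hs' hα, smooth_loss hμ (by linarith) hκ hs' hβ,
    fun x hx => abs_loss_le (by linarith) hκ hs' hB hx, lossMin y μ s, lossMin_mem_ball hs hd,
    fun z => ?_⟩
  have := add_norm_sq_le_loss hμ.ne' hκ hs hy hα z
  nlinarith [sq_nonneg ‖z - lossMin y μ s‖]

/-- The loss in excess of the minimum dominates the squared distance to the minimizer. -/
theorem norm_sub_lossMin_sq_le {y α : ℝ} (hμ : μ ≠ 0) (hκ : 0 ≤ κ) (hα0 : 0 ≤ α)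
    (hs : ∀ i, s i = 1 ∨ s i = -1) (hy : a * y = κ * Real.cos y) (hα : α ≤ a - κ)
    (hd : d * (y * μ) ^ 2 ≤ 1) (z : E d) :
    α / 2 * ‖z - lossMin y μ s‖ ^ 2 ≤ loss a κ μ s z - sInf (loss a κ μ s '' Ball d) := by
  have h := add_norm_sq_le_loss hμ hκ hs hy hα
  have h2 : sInf (loss a κ μ s '' Ball d) ≤ loss a κ μ s (lossMin y μ s) := by
    refine csInf_le ⟨loss a κ μ s (lossMin y μ s), ?_⟩ ⟨_, lossMin_mem_ball hs hd, rfl⟩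
    rintro _ ⟨x, -, rfl⟩
    nlinarith [h x, sq_nonneg ‖x - lossMin y μ s‖]
  linarith [h z]

/-- The price in total variation of a block boundary, where all `d` signs may change at once. -/
theorem abs_loss_sub_loss_le (hκ : 0 ≤ κ) (hs : ∀ i, |s i| ≤ 1) (hs' : ∀ i, |s' i| ≤ 1)
    (z : E d) : |loss a κ μ s z - loss a κ μ s' z| ≤ 2 * κ * (d * μ ^ 2) := by
  have h : loss a κ μ s z - loss a κ μ s' z =
      κ * μ ^ 2 * (∑ i, s' i * Real.sin (z i / μ) - ∑ i, s i * Real.sin (z i / μ)) := by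
    simp only [loss]; ring
  rw [h, abs_mul, abs_of_nonneg (by positivity : 0 ≤ κ * μ ^ 2)]
  have := (abs_sub (∑ i, s' i * Real.sin (z i / μ)) (∑ i, s i * Real.sin (z i / μ))).trans
    (add_le_add (abs_sum_mul_sin_le hs' z) (abs_sum_mul_sin_le hs z))
  calc _ ≤ κ * μ ^ 2 * (d + d) := by gcongr
    _ = _ := by ring

/-- Losses whose signs differ in a single coordinate differ by at most `2 κ μ²`. -/
theorem abs_loss_sub_loss_le_of_eq (hκ : 0 ≤ κ) (hs : ∀ i, |s i| ≤ 1) (hs' : ∀ i, |s' i| ≤ 1)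
    (j : Fin d) (h : ∀ i ≠ j, s i = s' i) (z : E d) :
    |loss a κ μ s z - loss a κ μ s' z| ≤ 2 * κ * μ ^ 2 := by
  have h : loss a κ μ s z - loss a κ μ s' z =
      κ * μ ^ 2 * ((s' j - s j) * Real.sin (z j / μ)) := by
    have : ∑ i, (s' i - s i) * Real.sin (z i / μ) = (s' j - s j) * Real.sin (z j / μ) :=
      Finset.sum_eq_single j (fun i _ hi => by rw [h i hi]; simp) (by simp)
    rw [← this]
    simp only [loss, sub_mul, Finset.sum_sub_distrib]; ring
  rw [h, abs_mul, abs_of_nonneg (by positivity : 0 ≤ κ * μ ^ 2), abs_mul]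
  have h1 := (abs_sub (s' j) (s j)).trans (add_le_add (hs' j) (hs j))
  calc _ ≤ κ * μ ^ 2 * ((1 + 1) * 1) := by
        gcongr
        exact Real.abs_sin_le_one _
    _ = _ := by ring

end

section

/-! ### Change of measure for the interaction -/

/-- The Donsker–Varadhan inequality for bounded functions. -/
theorem integral_le_klDiv_add_log {Ω : Type*} [MeasurableSpace Ω] {P Q : Measure Ω}
    [IsProbabilityMeasure P] [IsProbabilityMeasure Q] {k C : ℝ} (hk0 : 0 ≤ k)
    (hk : klDiv P Q ≤ ENNReal.ofReal k) {h : Ω → ℝ} (hm : Measurable h) (hC : ∀ x, |h x| ≤ C) :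
    ∫ x, h x ∂P ≤ k + Real.log (∫ x, Real.exp (h x) ∂Q) := by
  have htop : klDiv P Q ≠ ∞ := ne_top_of_le_ne_top ENNReal.ofReal_ne_top hk
  obtain ⟨hac, hint⟩ := klDiv_ne_top_iff.1 htop
  have hP : Integrable h P := .of_bound hm.aestronglyMeasurable C (.of_forall hC)
  have hQ : Integrable (fun x => Real.exp (h x)) Q := by
    refine .of_bound hm.exp.aestronglyMeasurable (Real.exp C) (.of_forall fun x => ?_)
    rw [Real.norm_eq_abs, Real.abs_exp, Real.exp_le_exp]
    exact (le_abs_self _).trans (hC x)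
  have := isProbabilityMeasure_tilted hQ
  -- The inequality is the nonnegativity of the divergence of `P` from `Q` tilted by `h`.
  have h1 := integral_llr_add_sub_measure_univ_nonneg
    (hac.trans (absolutelyContinuous_tilted hQ)) (integrable_llr_tilted_right hac hP hint hQ)
  rw [integral_llr_tilted_right hac hP hQ hint] at h1
  have h2 : ∫ x, llr P Q x ∂P ≤ k := by
    have := ENNReal.toReal_mono ENNReal.ofReal_ne_top hk
    rwa [toReal_klDiv_of_measure_eq hac (by simp), ENNReal.toReal_ofReal hk0] at this
  simp only [probReal_univ] at h1
  linarith

variable {d : ℕ} {U : Type*} [MeasurableSpace U]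

theorem measurable_finSnoc {X : Type*} [MeasurableSpace X] (t : ℕ) :
    Measurable fun p : (Fin t → X) × X => Fin.snoc (α := fun _ => X) p.1 p.2 := by
  refine measurable_pi_iff.2 fun i => ?_
  refine Fin.lastCases ?_ (fun j => ?_) i
  · simpa using measurable_snd
  · simp only [Fin.snoc_castSucc]
    exact (measurable_pi_apply j).comp measurable_fst

variable {A : RandomizedAlgorithm d U} {f f' : ℕ → E d → ℝ}

/-- The history after one more round, as a function of the history and of the noise. -/
noncomputable def nextHistory (A : RandomizedAlgorithm d U) (f : ℕ → E d → ℝ) (u : U) (t : ℕ)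
    (H : Fin t → E d × ℝ) (x : ℝ) : Fin (t + 1) → E d × ℝ :=
  Fin.snoc (α := fun _ => E d × ℝ) H (A.act t u H, f t (A.act t u H) + x)

theorem history_succ (u : U) (ξ : ℕ → ℝ) (t : ℕ) :
    history A f u ξ (t + 1) = nextHistory A f u t (history A f u ξ t) (ξ t) := rfl

theorem measurable_nextHistory (hf : ∀ t, Measurable (f t)) (t : ℕ) :
    Measurable fun p : U × (Fin t → E d × ℝ) × ℝ => nextHistory A f p.1 t p.2.1 p.2.2 := by
  have h1 : Measurable fun p : U × (Fin t → E d × ℝ) × ℝ => A.act t p.1 p.2.1 :=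
    (A.measurable_act t).comp (measurable_fst.prodMk measurable_snd.fst)
  exact (measurable_finSnoc t).comp (measurable_snd.fst.prodMk
    (h1.prodMk (((hf t).comp h1).add measurable_snd.snd)))

theorem measurable_history (hf : ∀ t, Measurable (f t)) (t : ℕ) :
    Measurable fun p : U × (ℕ → ℝ) => history A f p.1 p.2 t := by
  induction t with
  | zero => exact measurable_pi_iff.2 fun i => i.elim0
  | succ t ih =>
    exact (measurable_nextHistory hf t).comp (measurable_fst.prodMk
      (ih.prodMk ((measurable_pi_apply t).comp measurable_snd)))

theorem measurable_action (hf : ∀ t, Measurable (f t)) (t : ℕ) :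
    Measurable fun p : U × (ℕ → ℝ) => action A f p.1 p.2 t :=
  (A.measurable_act t).comp (measurable_fst.prodMk (measurable_history hf t))

theorem history_congr {u : U} {ξ ξ' : ℕ → ℝ} (t : ℕ) (h : ∀ s < t, ξ s = ξ' s) :
    history A f u ξ t = history A f u ξ' t := by
  induction t with
  | zero => rfl
  | succ t ih =>
    rw [history_succ, history_succ, ih fun s hs => h s (hs.trans t.lt_succ_self),
      h t t.lt_succ_self]

/-- The noise of a round is independent of the history before it. -/
theorem indepFun_history (F : Measure ℝ) [IsProbabilityMeasure F] (hf : ∀ t, Measurable (f t))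
    (u : U) (t : ℕ) :
    IndepFun (fun ξ : ℕ → ℝ => history A f u ξ t) (fun ξ => ξ t)
      (Measure.infinitePi fun _ : ℕ => F) := by
  have h := (iIndepFun_infinitePi (P := fun _ : ℕ => F) (X := fun _ x => x)
    fun _ => measurable_id).indepFun_finset (Finset.range t) {t} (by simp)
    (fun i => measurable_pi_apply i)
  -- The history before round `t` depends only on the noise of earlier rounds, so the value `0`
  -- filled in elsewhere is immaterial.
  let ext : (Finset.range t → ℝ) → ℕ → ℝ := fun r s =>
    if hs : s ∈ Finset.range t then r ⟨s, hs⟩ else 0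
  have hext : Measurable ext := by
    refine measurable_pi_iff.2 fun s => ?_
    by_cases hs : s ∈ Finset.range t
    · simp only [ext, hs, dite_true]
      exact measurable_pi_apply (X := fun _ : Finset.range t => ℝ) ⟨s, hs⟩
    · simp only [ext, hs, dite_false]
      exact measurable_const
  have h2 := h.comp (φ := fun r => history A f u (ext r) t)
    (ψ := fun r => r ⟨t, Finset.mem_singleton_self t⟩)
    ((measurable_history hf t).comp (measurable_const.prodMk hext))
    (measurable_pi_apply (X := fun _ : ({t} : Finset ℕ) => ℝ) ⟨t, Finset.mem_singleton_self t⟩)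
  refine h2.congr ?_ ?_
  · refine .of_forall fun ξ => history_congr t fun s hs => ?_
    simp [ext, hs]
  · exact .of_forall fun ξ => rfl

/-- By independence the past and the fresh noise have a product law, and Fubini's theorem applies
because `G` is bounded. -/
theorem integral_history_succ (F : Measure ℝ) [IsProbabilityMeasure F]
    (hf : ∀ t, Measurable (f t)) (u : U) (t : ℕ) {G : (Fin (t + 1) → E d × ℝ) → ℝ}
    (hG : Measurable G) {C : ℝ} (hC : ∀ H, |G H| ≤ C) :
    ∫ ξ, G (history A f u ξ (t + 1)) ∂(Measure.infinitePi fun _ : ℕ => F) =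
      ∫ ξ, (∫ x, G (nextHistory A f u t (history A f u ξ t) x) ∂F)
        ∂(Measure.infinitePi fun _ : ℕ => F) := by
  have hH : Measurable fun ξ : ℕ → ℝ => history A f u ξ t :=
    (measurable_history hf t).comp (measurable_const.prodMk measurable_id)
  have hg : Measurable fun p : (Fin t → E d × ℝ) × ℝ => G (nextHistory A f u t p.1 p.2) :=
    hG.comp ((measurable_nextHistory hf t).comp (measurable_const.prodMk measurable_id))
  have hprod := (indepFun_history (A := A) F hf u t).map_prod_eq_prod_map_map hH.aemeasurable
    (measurable_pi_apply t).aemeasurable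
  rw [Measure.infinitePi_map_eval] at hprod
  have := Measure.isProbabilityMeasure_map (μ := Measure.infinitePi fun _ : ℕ => F) hH.aemeasurable
  calc _ = ∫ p, G (nextHistory A f u t p.1 p.2)
        ∂((Measure.infinitePi fun _ : ℕ => F).map fun ξ => (history A f u ξ t, ξ t)) := by
        rw [integral_map (hH.prodMk (measurable_pi_apply t)).aemeasurable
          hg.aestronglyMeasurable]
        rfl
    _ = ∫ H, (∫ x, G (nextHistory A f u t H x) ∂F)
        ∂((Measure.infinitePi fun _ : ℕ => F).map fun ξ => history A f u ξ t) := by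
        rw [hprod, integral_prod]
        exact .of_bound hg.aestronglyMeasurable C (.of_forall fun p => hC _)
    _ = _ := by
        rw [integral_map hH.aemeasurable]
        exact (hg.stronglyMeasurable.integral_prod_right').aestronglyMeasurable

/-- Change of measure for a single observation, when the two losses differ by a shift at which
the divergence of the noise is at most `k`. -/
theorem integral_nextHistory_le {F : Measure ℝ} [IsProbabilityMeasure F]
    (hf : ∀ t, Measurable (f t)) (u : U) (t : ℕ) {k : ℝ} (hk0 : 0 ≤ k)
    (hk : ∀ z ∈ Ball d, klDiv F (F.map fun x => x - (f t z - f' t z)) ≤ ENNReal.ofReal k)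
    {G : (Fin (t + 1) → E d × ℝ) → ℝ} (hG : Measurable G) {C : ℝ} (hC : ∀ H, |G H| ≤ C)
    (H : Fin t → E d × ℝ) :
    ∫ x, G (nextHistory A f u t H x) ∂F ≤
      k + Real.log (∫ x, Real.exp (G (nextHistory A f' u t H x)) ∂F) := by
  set z := A.act t u H with hz
  have hsub : Measurable fun x : ℝ => x - (f t z - f' t z) := by fun_prop
  have := Measure.isProbabilityMeasure_map (μ := F) hsub.aemeasurable
  have hm : Measurable fun x => G (nextHistory A f u t H x) :=
    hG.comp ((measurable_nextHistory hf t).comp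
      (measurable_const.prodMk (measurable_const.prodMk measurable_id)))
  refine (integral_le_klDiv_add_log hk0 (hk z (A.act_mem t u H)) hm fun x => hC _).trans_eq ?_
  -- Both environments see the same action after the same history, so translating the noise by the
  -- difference of the losses there turns feedback of `f` into feedback of `f'`.
  rw [integral_map hsub.aemeasurable hm.exp.aestronglyMeasurable]
  congr 3 with x
  simp only [nextHistory, ← hz]
  congr 4
  ring

theorem integrable_of_abs_le {Ω : Type*} [MeasurableSpace Ω] {P : Measure Ω} [IsFiniteMeasure P]
    {g : Ω → ℝ} (hg : Measurable g) {C : ℝ} (hC : ∀ x, |g x| ≤ C) : Integrable g P :=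
  .of_bound hg.aestronglyMeasurable C (.of_forall hC)

/-- Change of measure for the whole interaction, at a fixed seed. -/
theorem integral_history_le {F : Measure ℝ} [IsProbabilityMeasure F]
    (hf : ∀ t, Measurable (f t)) (hf' : ∀ t, Measurable (f' t)) (u : U) {k : ℕ → ℝ}
    (hk0 : ∀ t, 0 ≤ k t) (t : ℕ)
    (hk : ∀ s < t, ∀ z ∈ Ball d,
      klDiv F (F.map fun x => x - (f s z - f' s z)) ≤ ENNReal.ofReal (k s))
    {G : (Fin t → E d × ℝ) → ℝ} (hG : Measurable G) {C : ℝ} (hC : ∀ H, |G H| ≤ C) :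
    ∫ ξ, G (history A f u ξ t) ∂(Measure.infinitePi fun _ : ℕ => F) ≤
      ∑ s ∈ Finset.range t, k s +
        Real.log (∫ ξ, Real.exp (G (history A f' u ξ t)) ∂(Measure.infinitePi fun _ : ℕ => F)) := by
  induction t with
  | zero =>
    have h : ∀ (g : ℕ → E d → ℝ) ξ, history A g u ξ 0 = Fin.elim0 := fun g ξ => rfl
    simp [h]
  | succ t ih =>
    have hCexp : ∀ H, |Real.exp (G H)| ≤ Real.exp C := fun H => by
      rw [Real.abs_exp, Real.exp_le_exp]
      exact (le_abs_self _).trans (hC H)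
    have hexpC : ∀ H, Real.exp (-C) ≤ Real.exp (G H) := fun H =>
      Real.exp_le_exp.2 (abs_le.1 (hC H)).1
    have hnext : ∀ {g : ℕ → E d → ℝ}, (∀ t, Measurable (g t)) →
        Measurable fun p : (Fin t → E d × ℝ) × ℝ => nextHistory A g u t p.1 p.2 := fun hg =>
      (measurable_nextHistory hg t).comp (measurable_const.prodMk measurable_id)
    have hHist : Measurable fun ξ : ℕ → ℝ => history A f u ξ t :=
      (measurable_history hf t).comp (measurable_const.prodMk measurable_id)
    set M : (Fin t → E d × ℝ) → ℝ := fun H => ∫ x, Real.exp (G (nextHistory A f' u t H x)) ∂F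
      with hM
    have hMm : Measurable M :=
      ((hG.comp (hnext hf')).exp.stronglyMeasurable.integral_prod_right').measurable
    have hslice : ∀ H, Integrable (fun x => Real.exp (G (nextHistory A f' u t H x))) F := fun H =>
      integrable_of_abs_le ((hG.comp (hnext hf')).exp.comp measurable_prodMk_left)
        fun x => hCexp _
    have hMlo : ∀ H, Real.exp (-C) ≤ M H := fun H => by
      have := integral_mono (integrable_const (μ := F) (Real.exp (-C))) (hslice H)
        fun x => hexpC _
      simpa using this
    have hMhi : ∀ H, M H ≤ Real.exp C := fun H => by
      have := integral_mono (hslice H) (integrable_const (μ := F) (Real.exp C))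
        fun x => (le_abs_self _).trans (hCexp _)
      simpa using this
    have hMpos : ∀ H, 0 < M H := fun H => (Real.exp_pos _).trans_le (hMlo H)
    have hlog : ∀ H, |Real.log (M H)| ≤ C := fun H => by
      rw [abs_le]
      exact ⟨(Real.le_log_iff_exp_le (hMpos H)).2 (hMlo H),
        (Real.log_le_iff_le_exp (hMpos H)).2 (hMhi H)⟩
    have hinner : Measurable fun H => ∫ x, G (nextHistory A f u t H x) ∂F :=
      ((hG.comp (hnext hf)).stronglyMeasurable.integral_prod_right').measurable
    have hinnerC : ∀ H, |∫ x, G (nextHistory A f u t H x) ∂F| ≤ C := fun H => by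
      refine (abs_integral_le_integral_abs).trans ?_
      have := integral_mono (μ := F) (integrable_of_abs_le
        ((hG.comp (hnext hf)).comp measurable_prodMk_left).abs fun x => (abs_abs _).le.trans (hC _))
        (integrable_const C) (fun x => hC (nextHistory A f u t H x))
      simpa using this
    -- The last round replaces the test function `G` by `log M`, which obeys the same bound `C`. In
    -- the induction hypothesis `exp (log M) = M`, and the outer integral of `M` is that of `exp G`
    -- over one more round.
    have hstep := ih (fun s hs => hk s (hs.trans t.lt_succ_self)) hMm.log hlog
    rw [integral_history_succ F hf u t hG hC,
      integral_history_succ F hf' u t hG.exp hCexp, Finset.sum_range_succ]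
    calc _ ≤ ∫ ξ, (k t + Real.log (M (history A f u ξ t)))
          ∂(Measure.infinitePi fun _ : ℕ => F) := by
          refine integral_mono (integrable_of_abs_le (hinner.comp hHist) fun ξ => hinnerC _)
            ((integrable_const _).add (integrable_of_abs_le (hMm.log.comp hHist) fun ξ => hlog _))
            fun ξ => ?_
          exact integral_nextHistory_le hf u t (hk0 t) (hk t t.lt_succ_self) hG hC _
      _ = k t + ∫ ξ, Real.log (M (history A f u ξ t)) ∂(Measure.infinitePi fun _ : ℕ => F) := by
          refine (integral_add (integrable_const _)
            (integrable_of_abs_le (hMm.log.comp hHist) fun ξ => hlog _)).trans ?_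
          simp
      _ ≤ _ := by
          simp only [Real.exp_log (hMpos _)] at hstep
          linarith

/-- Under a small total divergence, an event of the interaction with `f` forces an event of the
interaction with `f'`. -/
theorem integral_indicator_action_le {F : Measure ℝ} [IsProbabilityMeasure F]
    (hf : ∀ t, Measurable (f t)) (hf' : ∀ t, Measurable (f' t)) (u : U) {k : ℕ → ℝ}
    (hk0 : ∀ t, 0 ≤ k t) (t : ℕ)
    (hk : ∀ s < t, ∀ z ∈ Ball d,
      klDiv F (F.map fun x => x - (f s z - f' s z)) ≤ ENNReal.ofReal (k s))
    {V : Set (E d)} (hV : MeasurableSet V) :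
    ∫ ξ, V.indicator 1 (action A f u ξ t) ∂(Measure.infinitePi fun _ : ℕ => F) ≤
      ∑ s ∈ Finset.range t, k s +
        2 * ∫ ξ, V.indicator 1 (action A f' u ξ t) ∂(Measure.infinitePi fun _ : ℕ => F) := by
  set P := Measure.infinitePi fun _ : ℕ => F
  set G : (Fin t → E d × ℝ) → ℝ := fun H => V.indicator 1 (A.act t u H)
  have hV1 : Measurable (V.indicator (1 : E d → ℝ)) := measurable_one.indicator hV
  have hG : Measurable G := hV1.comp ((A.measurable_act t).comp
    (measurable_const.prodMk measurable_id))
  have hcases : ∀ z, V.indicator (1 : E d → ℝ) z = 0 ∨ V.indicator (1 : E d → ℝ) z = 1 :=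
    fun z => by by_cases hz : z ∈ V <;> simp [hz]
  have hC : ∀ H, |G H| ≤ 1 := fun H => by
    rcases hcases (A.act t u H) with h | h <;> simp [G, h]
  have h := integral_history_le (A := A) hf hf' u hk0 t hk hG hC
  have hHist : Measurable fun ξ : ℕ → ℝ => history A f' u ξ t :=
    (measurable_history hf' t).comp (measurable_const.prodMk measurable_id)
  have hint : Integrable (fun ξ => G (history A f' u ξ t)) P :=
    integrable_of_abs_le (hG.comp hHist) fun ξ => hC _
  -- As `e < 3`, `exp v ≤ 1 + 2 v` for `v` equal to `0` or `1`; with `log x ≤ x - 1` this gives the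
  -- factor `2`.
  have hexp : ∫ ξ, Real.exp (G (history A f' u ξ t)) ∂P ≤
      1 + 2 * ∫ ξ, G (history A f' u ξ t) ∂P := by
    rw [← integral_const_mul]
    have h1 : (1 : ℝ) = ∫ _ξ, (1 : ℝ) ∂P := by simp
    rw [h1, ← integral_add (integrable_const _) (hint.const_mul 2)]
    refine integral_mono (integrable_of_abs_le (C := Real.exp 1) (hG.comp hHist).exp fun ξ => ?_)
      ((integrable_const _).add (hint.const_mul 2)) fun ξ => ?_
    · rw [Real.abs_exp, Real.exp_le_exp]
      exact (le_abs_self _).trans (hC _)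
    · have := Real.exp_one_lt_d9
      rcases hcases (A.act t u (history A f' u ξ t)) with h | h <;> simp [G, h]
      linarith
  have hlog := Real.log_le_sub_one_of_pos
    (x := ∫ ξ, Real.exp (G (history A f' u ξ t)) ∂P) (integral_exp_pos (integrable_of_abs_le
      (C := Real.exp 1) (hG.comp hHist).exp fun ξ => by
        rw [Real.abs_exp, Real.exp_le_exp]
        exact (le_abs_self _).trans (hC _)))
  change ∫ ξ, G (history A f u ξ t) ∂P ≤ _ + 2 * ∫ ξ, G (history A f' u ξ t) ∂P
  linarith

end

section

/-! ### Environments with random signs on blocks of rounds -/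

/-- The sign encoded by a Boolean. -/
def boolSign (c : Bool) : ℝ := if c then 1 else -1

theorem boolSign_eq (c : Bool) : boolSign c = 1 ∨ boolSign c = -1 := by
  cases c <;> simp [boolSign]

theorem abs_boolSign_le (c : Bool) : |boolSign c| ≤ 1 := by
  cases c <;> simp [boolSign]

theorem boolSign_not (c : Bool) : boolSign (!c) = -boolSign c := by
  cases c <;> simp [boolSign]

theorem boolSign_mul_self (c : Bool) : boolSign c * boolSign c = 1 := by
  cases c <;> simp [boolSign]

/-- The losses with signs `σ (b t, ·)` in round `t`, where `b t` is the block of the round. -/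
noncomputable def blockEnv {d : ℕ} {J : Type*} (a κ μ : ℝ) (b : ℕ → J) (σ : J × Fin d → Bool)
    (t : ℕ) : E d → ℝ :=
  loss a κ μ fun i => boolSign (σ (b t, i))

/-- Changes a single sign. -/
def flipSign {ι : Type*} [DecidableEq ι] (p : ι) (σ : ι → Bool) : ι → Bool :=
  Function.update σ p (!σ p)

theorem flipSign_involutive {ι : Type*} [DecidableEq ι] (p : ι) :
    Function.Involutive (flipSign p) := fun σ => by
  simp [flipSign]

theorem sum_flipSign {ι : Type*} [DecidableEq ι] [Fintype ι] (p : ι) (r : (ι → Bool) → ℝ) :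
    ∑ σ, r (flipSign p σ) = ∑ σ, r σ :=
  Equiv.sum_comp (flipSign_involutive p).toPerm r

variable {d : ℕ} {U : Type*} [MeasurableSpace U] {J : Type*} {a κ μ : ℝ} {b : ℕ → J}

theorem measurable_loss {s : Fin d → ℝ} : Measurable (loss a κ μ s) :=
  contDiff_loss.continuous.measurable

theorem measurable_blockEnv (σ : J × Fin d → Bool) (t : ℕ) : Measurable (blockEnv a κ μ b σ t) :=
  measurable_loss

theorem abs_apply_le_of_mem_ball {z : E d} (hz : z ∈ Ball d) (i : Fin d) : |z i| ≤ 1 := by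
  have h1 : ‖z‖ ≤ 1 := by simpa [Ball] using hz
  exact (PiLp.norm_apply_le z i).trans h1

theorem measurable_action_apply {A : RandomizedAlgorithm d U} {f : ℕ → E d → ℝ}
    (hf : ∀ t, Measurable (f t)) (t : ℕ) (i : Fin d) :
    Measurable fun ω : U × (ℕ → ℝ) => action A f ω.1 ω.2 t i :=
  (EuclideanSpace.proj i : E d →L[ℝ] ℝ).continuous.measurable.comp (measurable_action hf t)

/-- The law of the seed and the noise. -/
noncomputable abbrev gameMeasure (A : RandomizedAlgorithm d U) (F : Measure ℝ)
    [IsProbabilityMeasure F] : Measure (U × (ℕ → ℝ)) :=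
  A.seedLaw.prod (Measure.infinitePi fun _ : ℕ => F)

/-- The mean squared distance between the `i`-th coordinates of the action and of the minimizer in
round `t`. -/
noncomputable def coordError (A : RandomizedAlgorithm d U) (F : Measure ℝ)
    [IsProbabilityMeasure F] (a κ μ y : ℝ) (b : ℕ → J) (t : ℕ) (i : Fin d)
    (σ : J × Fin d → Bool) : ℝ :=
  ∫ ω, (action A (blockEnv a κ μ b σ) ω.1 ω.2 t i - boolSign (σ (b t, i)) * (y * μ)) ^ 2
    ∂(gameMeasure A F)

theorem integrable_coordError (A : RandomizedAlgorithm d U) (F : Measure ℝ)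
    [IsProbabilityMeasure F] (t : ℕ) (i : Fin d) (σ : J × Fin d → Bool) (c : ℝ) :
    Integrable (fun ω : U × (ℕ → ℝ) => (action A (blockEnv a κ μ b σ) ω.1 ω.2 t i - c) ^ 2)
      (gameMeasure A F) := by
  refine integrable_of_abs_le (C := (1 + |c|) ^ 2)
    (((measurable_action_apply (measurable_blockEnv σ) t i).sub_const c).pow_const 2) fun ω => ?_
  rw [abs_pow]
  gcongr
  exact (abs_sub _ _).trans (by
    gcongr
    exact abs_apply_le_of_mem_ball (A.act_mem _ _ _) i)

/-- The shift depends on the action played; this bounds its divergence uniformly over the actions.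
-/
theorem klDiv_map_sub_le {F : Measure ℝ} [IsProbabilityMeasure F] {I₀ w v : ℝ} {v₀ : ℝ≥0∞}
    (hF : KLCondition F I₀ v₀) (hI : 0 ≤ I₀) (hw : ENNReal.ofReal w < v₀) (hv : |v| ≤ w) :
    klDiv F (F.map fun x => x - v) ≤ ENNReal.ofReal (I₀ * w ^ 2) := by
  refine (hF v ?_).trans (ENNReal.ofReal_le_ofReal ?_)
  · rw [← ofReal_norm, Real.norm_eq_abs]
    exact (ENNReal.ofReal_le_ofReal hv).trans_lt hw
  · rw [← sq_abs v]
    gcongr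

variable [DecidableEq J]

/-- No algorithm locates a coordinate of the minimizer for both values of its sign. -/
theorem le_coordError_add {F : Measure ℝ} [IsProbabilityMeasure F] {I₀ : ℝ} {v₀ : ℝ≥0∞}
    (hF : KLCondition F I₀ v₀) (hI : 0 ≤ I₀) (A : RandomizedAlgorithm d U) {y : ℝ}
    (hκ : 0 ≤ κ) (hy : 0 ≤ y) (hμ : 0 ≤ μ) (hw : ENNReal.ofReal (2 * κ * μ ^ 2) < v₀) (t : ℕ)
    (hb : ((Finset.range t).filter fun s => b s = b t).card * (I₀ * (2 * κ * μ ^ 2) ^ 2) ≤ 1 / 2)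
    (i : Fin d) (σ : J × Fin d → Bool) :
    (y * μ) ^ 2 / 2 ≤ coordError A F a κ μ y b t i σ +
      2 * coordError A F a κ μ y b t i (flipSign (b t, i) σ) := by
  set σ' := flipSign (b t, i) σ with hσ'
  set c := boolSign (σ (b t, i)) with hc
  set P := gameMeasure A F with hP
  have hc' : boolSign (σ' (b t, i)) = -c := by
    rw [hσ', flipSign, Function.update_self, boolSign_not]
  have hcc : c * c = 1 := boolSign_mul_self _
  -- `V` is the event that the action has the sign of the minimizer under `σ`, and hence the wrong
  -- sign under `σ'`.
  set V : Set (E d) := {z | 0 < c * z i} with hV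
  have hVm : MeasurableSet V := measurableSet_lt measurable_const
    ((EuclideanSpace.proj i : E d →L[ℝ] ℝ).continuous.measurable.const_mul c)
  -- Only rounds in the block of `t` involve the flipped sign; in all others the two losses
  -- coincide.
  set k : ℕ → ℝ := fun s => if b s = b t then I₀ * (2 * κ * μ ^ 2) ^ 2 else 0 with hk
  have hk0 : ∀ s, 0 ≤ k s := fun s => by simp only [hk]; split_ifs <;> positivity
  have hkl : ∀ s < t, ∀ z ∈ Ball d, klDiv F (F.map fun x => x -
      (blockEnv a κ μ b σ s z - blockEnv a κ μ b σ' s z)) ≤ ENNReal.ofReal (k s) := by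
    intro s _ z _
    by_cases hs : b s = b t
    · simp only [hk, hs, if_true]
      refine klDiv_map_sub_le hF hI hw ?_
      refine abs_loss_sub_loss_le_of_eq hκ (fun _ => abs_boolSign_le _)
        (fun _ => abs_boolSign_le _) i (fun j hj => ?_) z
      rw [hσ', flipSign, Function.update_of_ne]
      simp [hj]
    · have : blockEnv a κ μ b σ s = blockEnv a κ μ b σ' s := by
        simp only [blockEnv]
        congr 1 with j
        rw [hσ', flipSign, Function.update_of_ne]
        simp [hs]
      simp [this, klDiv_self]
  have hsum : ∑ s ∈ Finset.range t, k s ≤ 1 / 2 := by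
    simp only [hk]
    rw [← Finset.sum_filter, Finset.sum_const, nsmul_eq_mul]
    exact hb
  have hV1 : Measurable (V.indicator (1 : E d → ℝ)) := measurable_one.indicator hVm
  have hV01 : ∀ z, |V.indicator (1 : E d → ℝ) z| ≤ 1 := fun z => by
    by_cases hz : z ∈ V <;> simp [hz]
  have hint : ∀ τ : J × Fin d → Bool, Integrable (fun ω : U × (ℕ → ℝ) =>
      V.indicator (1 : E d → ℝ) (action A (blockEnv a κ μ b τ) ω.1 ω.2 t)) P := fun τ =>
    integrable_of_abs_le (hV1.comp (measurable_action (measurable_blockEnv τ) t)) fun ω => hV01 _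
  have htest : ∫ ω, V.indicator (1 : E d → ℝ) (action A (blockEnv a κ μ b σ) ω.1 ω.2 t) ∂P ≤
      1 / 2 + 2 * ∫ ω, V.indicator (1 : E d → ℝ)
        (action A (blockEnv a κ μ b σ') ω.1 ω.2 t) ∂P := by
    -- The comparison holds for each value of the seed and is then averaged over it.
    rw [integral_prod _ (hint σ), integral_prod _ (hint σ'), ← integral_const_mul]
    have h1 : (1 / 2 : ℝ) = ∫ _u, (1 / 2 : ℝ) ∂A.seedLaw := by simp
    rw [h1, ← integral_add (integrable_const _) ((hint σ').integral_prod_left.const_mul 2)]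
    refine integral_mono (hint σ).integral_prod_left
      ((integrable_const _).add ((hint σ').integral_prod_left.const_mul 2)) fun u => ?_
    exact (integral_indicator_action_le (measurable_blockEnv σ) (measurable_blockEnv σ') u hk0 t
      hkl hVm).trans (by simpa using hsum)
  have hyμ : 0 ≤ y * μ := mul_nonneg hy hμ
  have hlow : (y * μ) ^ 2 * (1 - ∫ ω, V.indicator (1 : E d → ℝ)
      (action A (blockEnv a κ μ b σ) ω.1 ω.2 t) ∂P) ≤ coordError A F a κ μ y b t i σ := by
    have h1 : (1 : ℝ) = ∫ _ω, (1 : ℝ) ∂P := by simp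
    rw [h1, ← integral_sub (integrable_const _) (hint σ), ← integral_const_mul]
    refine integral_mono (((integrable_const _).sub (hint σ)).const_mul _)
      (integrable_coordError A F t i σ _) fun ω => ?_
    set z := action A (blockEnv a κ μ b σ) ω.1 ω.2 t
    by_cases hz : z ∈ V
    · simpa [hz] using sq_nonneg _
    · have hz' : c * z i ≤ 0 := not_lt.1 hz
      simp only [hz, not_false_eq_true, Set.indicator_of_notMem, sub_zero, mul_one, ← hc]
      nlinarith [mul_nonneg hyμ (neg_nonneg.2 hz'), sq_nonneg (z i)]
  have hlow' : (y * μ) ^ 2 * ∫ ω, V.indicator (1 : E d → ℝ)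
      (action A (blockEnv a κ μ b σ') ω.1 ω.2 t) ∂P ≤ coordError A F a κ μ y b t i σ' := by
    rw [← integral_const_mul]
    refine integral_mono ((hint σ').const_mul _) (integrable_coordError A F t i σ' _) fun ω => ?_
    set z := action A (blockEnv a κ μ b σ') ω.1 ω.2 t
    by_cases hz : z ∈ V
    · have hz' : 0 ≤ c * z i := le_of_lt hz
      simp only [hz, Set.indicator_of_mem, Pi.one_apply, mul_one, hc']
      nlinarith [mul_nonneg hyμ hz', sq_nonneg (z i)]
    · simpa [hz] using sq_nonneg _
  -- With `p` and `p'` the probabilities of `V` under `σ` and `σ'`, the right-hand side is at least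
  -- `(y μ)² (1 - p + 2 p')`, and `p ≤ 1/2 + 2 p'`.
  nlinarith [sq_nonneg (y * μ)]

variable [Fintype J]

/-- The regret of the best choice of signs is at least the average regret. -/
theorem exists_le_regret_blockEnv {F : Measure ℝ} [IsProbabilityMeasure F] {I₀ : ℝ} {v₀ : ℝ≥0∞}
    (hF : KLCondition F I₀ v₀) (hI : 0 ≤ I₀) (A : RandomizedAlgorithm d U) {y α B : ℝ}
    (hκ : 0 ≤ κ) (hy : 0 ≤ y) (hμ : 0 < μ) (hα0 : 0 ≤ α) (hα : α ≤ a - κ)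
    (hyκ : a * y = κ * Real.cos y) (hB : a / 4 + κ * (d * μ ^ 2) ≤ B)
    (hd : d * (y * μ) ^ 2 ≤ 1) (hw : ENNReal.ofReal (2 * κ * μ ^ 2) < v₀) (T : ℕ)
    (hb : ∀ t < T, ((Finset.range t).filter fun s => b s = b t).card *
      (I₀ * (2 * κ * μ ^ 2) ^ 2) ≤ 1 / 2) :
    ∃ σ : J × Fin d → Bool,
      T * (α * y ^ 2 / 12 * (d * μ ^ 2)) ≤ regret A F T (blockEnv a κ μ b σ) := by
  have hround : ∀ σ : J × Fin d → Bool, ∀ t, α / 2 * ∑ i, coordError A F a κ μ y b t i σ ≤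
      ∫ ω, (blockEnv a κ μ b σ t (action A (blockEnv a κ μ b σ) ω.1 ω.2 t) -
        sInf (blockEnv a κ μ b σ t '' Ball d)) ∂(gameMeasure A F) := by
    intro σ t
    simp only [coordError]
    rw [← integral_finsetSum _ fun i _ => integrable_coordError A F t i σ _, ← integral_const_mul]
    refine integral_mono ((integrable_finsetSum _ fun i _ =>
      integrable_coordError A F t i σ _).const_mul _) ?_ fun ω => ?_
    · refine integrable_of_abs_le (C := B + |sInf (blockEnv a κ μ b σ t '' Ball d)|)
        (((measurable_blockEnv σ t).comp (measurable_action (measurable_blockEnv σ) t)).sub_const _)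
        fun ω => (abs_sub _ _).trans ?_
      gcongr
      exact abs_loss_le (by linarith) hκ (fun _ => abs_boolSign_le _) hB (A.act_mem _ _ _)
    · have h := norm_sub_lossMin_sq_le hμ.ne' hκ hα0
        (s := fun i => boolSign (σ (b t, i))) (fun _ => boolSign_eq _) hyκ hα hd
        (action A (blockEnv a κ μ b σ) ω.1 ω.2 t)
      rw [EuclideanSpace.real_norm_sq_eq] at h
      exact h
  have herr : ∀ t < T, ∀ i, (Fintype.card (J × Fin d → Bool) : ℝ) * ((y * μ) ^ 2 / 2) ≤
      3 * ∑ σ, coordError A F a κ μ y b t i σ := by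
    intro t ht i
    -- Flipping a sign permutes the sign patterns, so both errors have the same sum and the weights
    -- `1` and `2` add up to `3`.
    have h := Finset.sum_le_sum (s := (Finset.univ : Finset (J × Fin d → Bool)))
      fun σ _ => le_coordError_add (a := a) hF hI A hκ hy hμ.le hw t (hb t ht) i σ
    rw [Finset.sum_add_distrib, ← Finset.mul_sum,
      sum_flipSign (b t, i) (coordError A F a κ μ y b t i), Finset.sum_const, nsmul_eq_mul] at h
    simp only [Finset.card_univ] at h
    linarith
  have htotal : ∑ _σ : J × Fin d → Bool, T * (α * y ^ 2 / 12 * (d * μ ^ 2)) ≤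
      ∑ σ, regret A F T (blockEnv a κ μ b σ) := by
    calc _ = ∑ _t ∈ Finset.range T, α / 2 * ∑ _i : Fin d,
          (Fintype.card (J × Fin d → Bool) : ℝ) * ((y * μ) ^ 2 / 2) / 3 := by
          simp only [Finset.sum_const, nsmul_eq_mul, Finset.card_univ, Finset.card_range,
            Fintype.card_fin]
          ring
      _ ≤ ∑ t ∈ Finset.range T, α / 2 * ∑ i, ∑ σ, coordError A F a κ μ y b t i σ := by
          refine Finset.sum_le_sum fun t ht => mul_le_mul_of_nonneg_left
            (Finset.sum_le_sum fun i _ => ?_) (by positivity)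
          linarith [herr t (Finset.mem_range.1 ht) i]
      _ = ∑ σ, ∑ t ∈ Finset.range T, α / 2 * ∑ i, coordError A F a κ μ y b t i σ := by
          rw [Finset.sum_comm]
          refine Finset.sum_congr rfl fun t _ => ?_
          rw [Finset.sum_comm, Finset.mul_sum]
      _ ≤ _ := Finset.sum_le_sum fun σ _ => Finset.sum_le_sum fun t _ => hround σ t
  obtain ⟨σ, -, hσ⟩ := Finset.exists_le_of_sum_le Finset.univ_nonempty htotal
  exact ⟨σ, hσ⟩

/-! ### Blocks of equal length -/

theorem card_filter_div_eq_le (n t : ℕ) (hn : 0 < n) :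
    ((Finset.range t).filter fun s => s / n = t / n).card ≤ n := by
  have : ((Finset.range t).filter fun s => s / n = t / n) ⊆
      Finset.Ico (n * (t / n)) (n * (t / n) + n) := fun s hs => by
    obtain ⟨-, h⟩ := Finset.mem_filter.1 hs
    rw [← h, Finset.mem_Ico]
    exact ⟨Nat.mul_div_le s n, by
      have := Nat.lt_mul_div_succ s hn
      rwa [Nat.mul_succ] at this⟩
  simpa using Finset.card_le_card this

/-- The number of block boundaries among the first rounds. -/
theorem sum_ite_div_succ (n m : ℕ) :
    ∑ t ∈ Finset.range m, (if t / n = (t + 1) / n then 0 else 1) = m / n := by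
  induction m with
  | zero => simp
  | succ m ih =>
    have h : (m + 1) / n = m / n + if n ∣ m + 1 then 1 else 0 := Nat.succ_div
    rw [Finset.sum_range_succ, ih]
    by_cases hd : n ∣ m + 1
    · rw [if_pos hd] at h
      rw [if_neg (by omega), h]
    · rw [if_neg hd, add_zero] at h
      rw [if_pos h.symm, h, add_zero]

/-- The block of a round, for blocks of length `n` numbered cyclically. -/
def blockIndex (n T : ℕ) (hT : 0 < T) (t : ℕ) : Fin T := ⟨t / n % T, Nat.mod_lt _ hT⟩

/-- The reduction modulo `T` serves only to make the set of blocks finite; it is vacuous within the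
horizon. -/
theorem blockIndex_eq_iff {n T : ℕ} (hT : 0 < T) {s t : ℕ} (hs : s < T) (ht : t < T) :
    blockIndex n T hT s = blockIndex n T hT t ↔ s / n = t / n := by
  rw [blockIndex, blockIndex, Fin.mk.injEq, Nat.mod_eq_of_lt ((Nat.div_le_self _ _).trans_lt hs),
    Nat.mod_eq_of_lt ((Nat.div_le_self _ _).trans_lt ht)]

theorem isEnvironment_blockEnv {y α β B Δ : ℝ} {n T S : ℕ} (hT : 0 < T)
    (hκ : 0 ≤ κ) (hμ : 0 < μ) (hα0 : 0 ≤ α) (hα : α ≤ a - κ) (hβ : a + κ ≤ β)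
    (hyκ : a * y = κ * Real.cos y) (hB : a / 4 + κ * (d * μ ^ 2) ≤ B)
    (hd : d * (y * μ) ^ 2 ≤ 1) (hS : 1 + (T - 1) / n ≤ S)
    (hΔ : ((T - 1) / n : ℕ) * (2 * κ * (d * μ ^ 2)) ≤ Δ) (σ : Fin T × Fin d → Bool) :
    IsEnvironment α β B T S Δ (blockEnv a κ μ (blockIndex n T hT) σ) := by
  have hloss : ∀ t, IsLoss α β B (blockEnv a κ μ (blockIndex n T hT) σ t) := fun t =>
    isLoss_loss hμ hκ (fun _ => boolSign_eq _) hyκ hα0 hα hβ hB hd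
  have heq : ∀ t ∈ Finset.range (T - 1), t / n = (t + 1) / n →
      blockEnv a κ μ (blockIndex n T hT) σ (t + 1) = blockEnv a κ μ (blockIndex n T hT) σ t := by
    intro t ht h
    have ht := Finset.mem_range.1 ht
    rw [← blockIndex_eq_iff hT (by omega) (by omega)] at h
    simp [blockEnv, h]
  refine ⟨fun t _ => hloss t, ?_, ?_⟩
  · refine le_trans ?_ hΔ
    rw [totalVariation, ← sum_ite_div_succ n (T - 1), Nat.cast_sum, Finset.sum_mul]
    refine Finset.sum_le_sum fun t ht => ?_
    split_ifs with h
    · rw [heq t ht h]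
      refine (Real.sSup_le ?_ le_rfl).trans (by simp)
      rintro _ ⟨z, -, rfl⟩
      simp
    · rw [Nat.cast_one, one_mul]
      refine Real.sSup_le ?_ (by positivity)
      rintro _ ⟨z, -, rfl⟩
      exact abs_loss_sub_loss_le hκ (fun _ => abs_boolSign_le _) (fun _ => abs_boolSign_le _) z
  · refine le_trans ?_ hS
    rw [numSwitches, ← sum_ite_div_succ n (T - 1)]
    refine Nat.add_le_add_left (Finset.sum_le_sum fun t ht => ?_) 1
    by_cases h : t / n = (t + 1) / n
    · rw [if_pos]
      · simp
      · rw [heq t ht h, Set.inter_self]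
        obtain ⟨x, hx, hmin⟩ := (hloss t).minimizer_mem
        exact ⟨x, hx, fun z _ => hmin z⟩
    · rw [if_neg h]
      split_ifs <;> simp

end

section

/-! ### Choice of the parameters -/

/-- A curvature, an amplitude and a shift for which the perturbed quadratics are admissible. -/
theorem exists_loss_parameters {α β B : ℝ} (hα : 0 < α) (hαβ : α < β) (hB : α / 4 < B) :
    ∃ a κ y : ℝ, 0 < κ ∧ 0 < y ∧ y ≤ 1 ∧ a * y = κ * Real.cos y ∧ α ≤ a - κ ∧ a + κ ≤ β ∧
      a / 4 + κ ≤ B := by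
  obtain ⟨a, ha1, ha2⟩ := exists_between (lt_min hαβ (show α < 4 * B by linarith))
  obtain ⟨haβ, haB⟩ := lt_min_iff.1 ha2
  obtain ⟨κ₀, hκ0, hκ1⟩ := exists_between
    (lt_min (lt_min (sub_pos.2 ha1) (sub_pos.2 haβ)) (show 0 < B - a / 4 by linarith))
  obtain ⟨⟨h1, h2⟩, h3⟩ := (lt_min_iff.1 hκ1).imp lt_min_iff.1 id
  have ha : 0 < a := hα.trans ha1
  -- Instead of solving `a y = κ cos y` for `y`, choose `y` and define `κ` by the equation; `y ≤ 1`
  -- gives `cos y ≥ 1/2`, hence `κ ≤ 2 a y ≤ κ₀`.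
  set y := min 1 (κ₀ / (2 * a)) with hy
  have hy0 : 0 < y := lt_min one_pos (by positivity)
  have hy1 : y ≤ 1 := min_le_left _ _
  have hy2 : y * (2 * a) ≤ κ₀ := (le_div_iff₀ (by positivity)).1 (min_le_right _ _)
  have hcos : 1 / 2 ≤ Real.cos y := by
    have := Real.one_sub_sq_div_two_le_cos (x := y)
    nlinarith
  have hcos0 : 0 < Real.cos y := by linarith
  have hκ : a * y / Real.cos y ≤ κ₀ := by
    rw [div_le_iff₀ hcos0]
    nlinarith
  refine ⟨a, a * y / Real.cos y, y, by positivity, hy0, hy1, ?_, ?_, ?_, ?_⟩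
  · field_simp
  all_goals linarith

/-- A scale for the perturbations at which the feedback carries little information. -/
theorem exists_scale (κ I₀ : ℝ) {v₀ : ℝ≥0∞} (hv₀ : 0 < v₀) :
    ∃ θ : ℝ, 0 < θ ∧ θ ≤ 1 ∧ 2 * κ * θ ≤ 1 ∧ ENNReal.ofReal (2 * κ * θ) < v₀ ∧
      I₀ * (2 * κ * θ) ^ 2 ≤ 1 / 2 := by
  have h0 : Filter.Tendsto (fun θ : ℝ => 2 * κ * θ) (nhds 0) (nhds 0) := by
    have : Continuous fun θ : ℝ => 2 * κ * θ := by fun_prop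
    simpa using this.tendsto 0
  have h1 : ∀ᶠ θ : ℝ in nhds 0, θ ≤ 1 := eventually_le_nhds one_pos
  have h2 : ∀ᶠ θ : ℝ in nhds 0, 2 * κ * θ ≤ 1 := h0.eventually (eventually_le_nhds one_pos)
  have h3 : ∀ᶠ θ : ℝ in nhds 0, ENNReal.ofReal (2 * κ * θ) < v₀ := by
    have := (ENNReal.continuous_ofReal.tendsto 0).comp h0
    rw [ENNReal.ofReal_zero] at this
    exact this.eventually (eventually_lt_nhds hv₀)
  have h4 : ∀ᶠ θ : ℝ in nhds 0, I₀ * (2 * κ * θ) ^ 2 ≤ 1 / 2 := by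
    have := (h0.pow 2).const_mul I₀
    simp only [ne_eq, OfNat.ofNat_ne_zero, not_false_eq_true, zero_pow, mul_zero] at this
    exact this.eventually (eventually_le_nhds (by norm_num))
  have h5 : ∀ᶠ θ : ℝ in nhdsWithin 0 (Set.Ioi 0), 0 < θ := self_mem_nhdsWithin
  obtain ⟨θ, hθ0, hθ⟩ :=
    (h5.and ((h1.and (h2.and (h3.and h4))).filter_mono nhdsWithin_le_nhds)).exists
  exact ⟨θ, hθ0, hθ⟩

/-- The lower bound for environments that may change after every `n` rounds. -/
theorem exists_le_dynRegret_of_blockLength.{u} {α β B I₀ : ℝ} {v₀ : ℝ≥0∞} (hα : 0 < α)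
    (hαβ : α < β) (hB : α / 4 < B) (hI₀ : 0 < I₀) (hv₀ : 0 < v₀) :
    ∃ c : ℝ, 0 < c ∧ ∀ (F : Measure ℝ) [IsProbabilityMeasure F], KLCondition F I₀ v₀ →
      ∀ (d T S n : ℕ) (Δ : ℝ), 0 < d → 0 < T → 0 < n → 1 + (T - 1) / n ≤ S →
        ((T - 1) / n : ℕ) * (d / √n) ≤ Δ →
      ∀ (U : Type u) [MeasurableSpace U] (A : RandomizedAlgorithm d U),
        ((c * (T * min 1 (d / √n)) : ℝ) : EReal) ≤ dynRegret A F α β B T S Δ := by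
  obtain ⟨a, κ, y, hκ, hy, hy1, hyκ, hα', hβ', hB'⟩ := exists_loss_parameters hα hαβ hB
  obtain ⟨θ, hθ, hθ1, hκθ, hv, hI⟩ := exists_scale κ I₀ hv₀
  refine ⟨α * y ^ 2 / 12 * θ, by positivity, fun F _ hF d T S n Δ hd hT hn hS hΔ U _ A => ?_⟩
  have hd' : (0 : ℝ) < d := Nat.cast_pos.2 hd
  have hd1 : (1 : ℝ) ≤ d := Nat.one_le_cast.2 hd
  have hn' : (0 : ℝ) < n := Nat.cast_pos.2 hn
  have hsn : 0 < √(n : ℝ) := Real.sqrt_pos.2 hn'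
  set q : ℝ := min 1 (d / √n) with hq
  have hq0 : 0 < q := lt_min one_pos (by positivity)
  have hq1 : q ≤ 1 := min_le_left _ _
  -- Chosen so that `d μ² = θ q`, where `q` is the regret per round aimed at, up to a constant.
  set μ : ℝ := √(θ * q / d) with hμ
  have hμ0 : 0 < μ := Real.sqrt_pos.2 (by positivity)
  have hμ2 : μ ^ 2 = θ * q / d := Real.sq_sqrt (by positivity)
  have hdμ : d * μ ^ 2 = θ * q := by rw [hμ2]; field_simp
  have hμθ : μ ^ 2 ≤ θ := by
    have : θ * q ≤ θ := mul_le_of_le_one_right hθ.le hq1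
    nlinarith [sq_nonneg μ]
  -- The information budget: `n μ⁴ ≤ θ²` for a whole block.
  have hμn : μ ^ 2 * √n ≤ θ := by
    have h1 : q * √n ≤ d := (le_div_iff₀ hsn).1 (min_le_right _ _)
    rw [hμ2, div_mul_eq_mul_div, div_le_iff₀ hd', mul_assoc]
    gcongr
  have hdy : d * (y * μ) ^ 2 ≤ 1 := by
    have : d * (y * μ) ^ 2 = y ^ 2 * (θ * q) := by rw [← hdμ]; ring
    rw [this]
    exact mul_le_one₀ (pow_le_one₀ hy.le hy1) (by positivity) (mul_le_one₀ hθ1 hq0.le hq1)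
  have hBμ : a / 4 + κ * (d * μ ^ 2) ≤ B := by
    have : d * μ ^ 2 ≤ 1 := hdμ.trans_le (mul_le_one₀ hθ1 hq0.le hq1)
    nlinarith
  have hw : ENNReal.ofReal (2 * κ * μ ^ 2) < v₀ :=
    (ENNReal.ofReal_le_ofReal (by gcongr)).trans_lt hv
  have hΔμ : ((T - 1) / n : ℕ) * (2 * κ * (d * μ ^ 2)) ≤ Δ := by
    refine (mul_le_mul_of_nonneg_left ?_ (Nat.cast_nonneg _)).trans hΔ
    rw [hdμ, ← mul_assoc]
    exact (mul_le_of_le_one_left hq0.le hκθ).trans (min_le_right _ _)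
  have hb : ∀ t < T, ((Finset.range t).filter fun s =>
      blockIndex n T hT s = blockIndex n T hT t).card * (I₀ * (2 * κ * μ ^ 2) ^ 2) ≤ 1 / 2 := by
    intro t ht
    have hcard : ((Finset.range t).filter fun s =>
        blockIndex n T hT s = blockIndex n T hT t).card ≤ n := by
      refine (Finset.card_le_card fun s hs => ?_).trans (card_filter_div_eq_le n t hn)
      obtain ⟨h1, h2⟩ := Finset.mem_filter.1 hs
      exact Finset.mem_filter.2
        ⟨h1, (blockIndex_eq_iff hT ((Finset.mem_range.1 h1).trans ht) ht).1 h2⟩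
    calc _ ≤ (n : ℝ) * (I₀ * (2 * κ * μ ^ 2) ^ 2) := by gcongr
      _ = I₀ * (2 * κ * (μ ^ 2 * √n)) ^ 2 := by
          have := Real.sq_sqrt hn'.le
          linear_combination -(I₀ * (2 * κ * μ ^ 2) ^ 2) * this
      _ ≤ I₀ * (2 * κ * θ) ^ 2 := by gcongr
      _ ≤ 1 / 2 := hI
  obtain ⟨σ, hσ⟩ := exists_le_regret_blockEnv hF hI₀.le A hκ.le hy.le hμ0 hα.le hα' hyκ hBμ hdy
    hw T hb
  have henv := isEnvironment_blockEnv hT hκ.le hμ0 hα.le hα' hβ' hyκ hBμ hdy hS hΔμ σ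
  refine le_trans (EReal.coe_le_coe_iff.2 (le_trans (le_of_eq ?_) hσ))
    (le_iSup₂ (f := fun f (_ : IsEnvironment α β B T S Δ f) => ((regret A F T f : ℝ) : EReal))
      _ henv)
  rw [hdμ]
  ring

/-- The best block length. -/
theorem exists_blockLength (d T S : ℕ) (Δ : ℝ) (hd : 1 ≤ d) (hT : 1 ≤ T) (hS : 1 ≤ S)
    (hΔ : 0 ≤ Δ) : ∃ n : ℕ, 0 < n ∧ 1 + (T - 1) / n ≤ S ∧
      ((T - 1) / n : ℕ) * (d / √n) ≤ Δ ∧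
      min (T : ℝ) (min ((d : ℝ) * √((S : ℝ) * T))
        ((d : ℝ) ^ (2 / 3 : ℝ) * Δ ^ (1 / 3 : ℝ) * (T : ℝ) ^ (2 / 3 : ℝ))) ≤
          2 * (T * min 1 (d / √n)) := by
  have hdp : (1 : ℝ) ≤ d := Nat.one_le_cast.2 hd
  have hTp : (1 : ℝ) ≤ T := Nat.one_le_cast.2 hT
  have hSp : (1 : ℝ) ≤ S := Nat.one_le_cast.2 hS
  set M := min (T : ℝ) (min ((d : ℝ) * √((S : ℝ) * T))
        ((d : ℝ) ^ (2 / 3 : ℝ) * Δ ^ (1 / 3 : ℝ) * (T : ℝ) ^ (2 / 3 : ℝ))) with hM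
  have hM0 : 0 ≤ M := le_min (by positivity) (le_min (by positivity) (by positivity))
  have hM1 : M ≤ T := min_le_left _ _
  have hM2 : M ≤ d * √((S : ℝ) * T) := (min_le_right _ _).trans (min_le_left _ _)
  have hM3 : M ≤ (d : ℝ) ^ (2 / 3 : ℝ) * Δ ^ (1 / 3 : ℝ) * (T : ℝ) ^ (2 / 3 : ℝ) :=
    (min_le_right _ _).trans (min_le_right _ _)
  rcases hΔ.eq_or_lt with rfl | hΔ
  -- With no variation allowed, a single block covers the horizon; the bound to prove is then
  -- trivial.
  · have h0 : (T - 1) / T = 0 := Nat.div_eq_of_lt (by omega)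
    refine ⟨T, hT, by omega, by simp [h0], hM3.trans ?_⟩
    rw [Real.zero_rpow (by norm_num), mul_zero, zero_mul]
    positivity
  -- Passing to cube roots of `d`, `Δ` and `T` turns the fractional powers into monomials.
  have hcube : ∀ x : ℝ, 0 < x → ∃ r : ℝ, 0 < r ∧ x = r ^ 3 ∧ x ^ (1 / 3 : ℝ) = r ∧
      x ^ (2 / 3 : ℝ) = r ^ 2 := fun x hx => by
    refine ⟨x ^ (1 / 3 : ℝ), by positivity, ?_, rfl, ?_⟩
    · rw [← Real.rpow_natCast, ← Real.rpow_mul hx.le]; norm_num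
    · rw [← Real.rpow_natCast, ← Real.rpow_mul hx.le]; norm_num
  obtain ⟨p, hp, hp3, -, hp2⟩ := hcube d (by positivity)
  obtain ⟨e, he, he3, he1, -⟩ := hcube Δ hΔ
  obtain ⟨τ, hτ, hτ3, -, hτ2⟩ := hcube T (by positivity)
  rw [hp2, he1, hτ2] at hM3
  -- `T / S` is dictated by the switches, and `(p τ / e)² = (dT/Δ)^(2/3)` by the variation, which is
  -- at most `(T/n)(d/√n)`.
  set x : ℝ := max 1 (max (T / S) ((p * τ / e) ^ 2)) with hx
  have hx1 : 1 ≤ x := le_max_left _ _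
  have hx2 : T / S ≤ x := (le_max_left _ _).trans (le_max_right _ _)
  have hx3 : (p * τ / e) ^ 2 ≤ x := (le_max_right _ _).trans (le_max_right _ _)
  have hxn : x ≤ (⌈x⌉₊ : ℝ) := Nat.le_ceil x
  -- Since `x ≥ 1`, rounding up at most doubles it; the weaker factor `4` has an exact square root.
  have hnx : (⌈x⌉₊ : ℝ) ≤ 2 ^ 2 * x := by
    have := Nat.ceil_lt_add_one (by linarith : 0 ≤ x)
    linarith
  have hn0 : 0 < ⌈x⌉₊ := Nat.ceil_pos.2 (by linarith)
  generalize ⌈x⌉₊ = n at hxn hnx hn0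
  have hn' : (0 : ℝ) < n := Nat.cast_pos.2 hn0
  have hsn : 0 < √(n : ℝ) := Real.sqrt_pos.2 hn'
  refine ⟨n, hn0, ?_, ?_, ?_⟩
  · have h1 : (T : ℝ) ≤ ((n * S : ℕ) : ℝ) := by
      rw [Nat.cast_mul]
      exact (div_le_iff₀ (by positivity)).1 (hx2.trans hxn)
    have h2 : T ≤ n * S := Nat.cast_le.1 h1
    have h3 : (T - 1) / n < S := by
      rw [Nat.div_lt_iff_lt_mul hn0, mul_comm]
      omega
    omega
  · have h1 : (((T - 1) / n : ℕ) : ℝ) ≤ T / n :=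
      Nat.cast_div_le.trans (by gcongr; omega)
    have h2 : p * τ / e ≤ √n := Real.le_sqrt_of_sq_le (hx3.trans hxn)
    have h3 : (p * τ / e) ^ 3 ≤ n * √n := by
      calc _ ≤ √n ^ 3 := by gcongr
        _ = n * √n := by rw [pow_succ, Real.sq_sqrt hn'.le]
    calc _ ≤ (T : ℝ) / n * (d / √n) := by gcongr
      _ = T * d / (n * √n) := by field_simp
      _ ≤ Δ := by
        rw [div_le_iff₀ (by positivity)]
        calc (T : ℝ) * d = Δ * (p * τ / e) ^ 3 := by
              rw [hτ3, hp3, he3]; field_simp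
          _ ≤ _ := by gcongr
  · rw [mul_min_of_nonneg _ _ (by positivity), mul_one, mul_min_of_nonneg _ _ (by positivity)]
    refine le_min (by linarith) ?_
    rw [mul_div_assoc', mul_div_assoc', le_div_iff₀ hsn]
    have h1 : √(n : ℝ) ≤ 2 * √x := by
      refine (Real.sqrt_le_sqrt hnx).trans_eq ?_
      rw [Real.sqrt_mul (by positivity), Real.sqrt_sq (by positivity)]
    have h2 : M * √x ≤ T * d := by
      -- Whichever term attains the maximum, the corresponding term of `M` gives `M √x ≤ T d`.
      have hmax : x = 1 ∨ x = T / S ∨ x = (p * τ / e) ^ 2 := by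
        rcases max_choice (1 : ℝ) (max (T / S) ((p * τ / e) ^ 2)) with h | h
        · exact Or.inl h
        · rcases max_choice ((T : ℝ) / S) ((p * τ / e) ^ 2) with h' | h'
          · exact Or.inr (Or.inl (h.trans h'))
          · exact Or.inr (Or.inr (h.trans h'))
      rcases hmax with h | h | h
      · rw [h, Real.sqrt_one, mul_one]
        nlinarith
      · calc M * √x ≤ d * √((S : ℝ) * T) * √(T / S) := by rw [h]; gcongr
          _ = T * d := by
            rw [mul_assoc, ← Real.sqrt_mul (by positivity),
              show (S : ℝ) * T * (T / S) = (T : ℝ) ^ 2 by field_simp,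
              Real.sqrt_sq (by positivity)]
            ring
      · calc M * √x ≤ p ^ 2 * e * τ ^ 2 * (p * τ / e) := by
              rw [h, Real.sqrt_sq (by positivity)]; gcongr
          _ = T * d := by rw [hτ3, hp3]; field_simp
    calc M * √n ≤ M * (2 * √x) := by gcongr
      _ ≤ 2 * (T * d) := by linarith

/-- For long horizons the trivial bound `T` does not bind. -/
theorem min_le_of_sq_mul_min_le (d T S : ℕ) {Δ : ℝ} (hΔ : 0 ≤ Δ)
    (h : (d : ℝ) ^ 2 * min (S : ℝ) Δ ≤ T) :
    min ((d : ℝ) * √((S : ℝ) * T))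
      ((d : ℝ) ^ (2 / 3 : ℝ) * Δ ^ (1 / 3 : ℝ) * (T : ℝ) ^ (2 / 3 : ℝ)) ≤ T := by
  have hT : (0 : ℝ) ≤ T := Nat.cast_nonneg _
  -- If `d² S ≤ T`, then `d √(S T) ≤ T`; if `d² Δ ≤ T`, then `(d² Δ)^(1/3) T^(2/3) ≤ T`.
  rcases le_total (S : ℝ) Δ with hSΔ | hSΔ
  · rw [min_eq_left hSΔ] at h
    refine (min_le_left _ _).trans ?_
    refine abs_le_of_sq_le_sq' ?_ hT |>.2
    rw [mul_pow, Real.sq_sqrt (by positivity)]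
    nlinarith
  · rw [min_eq_right hSΔ] at h
    refine (min_le_right _ _).trans ?_
    have h1 : (d : ℝ) ^ (2 / 3 : ℝ) * Δ ^ (1 / 3 : ℝ) = ((d : ℝ) ^ 2 * Δ) ^ (1 / 3 : ℝ) := by
      rw [Real.mul_rpow (by positivity) hΔ, ← Real.rpow_natCast, ← Real.rpow_mul (by positivity)]
      norm_num
    calc _ ≤ (T : ℝ) ^ (1 / 3 : ℝ) * (T : ℝ) ^ (2 / 3 : ℝ) := by
          rw [h1]; gcongr
      _ = T := by
          rw [← Real.rpow_add_of_nonneg hT (by norm_num) (by norm_num)]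
          norm_num

end

end BanditLB

theorem mainTheorem3 (α β B I₀ : ℝ) (v₀ : ℝ≥0∞) (hα : 0 < α) (hαβ : α < β) (hB : α / 4 < B)
    (hI₀ : 0 < I₀) (hv₀ : 0 < v₀) :
    ∃ c : ℝ, 0 < c ∧
      ∀ (F : Measure ℝ) [IsProbabilityMeasure F], BanditLB.KLCondition F I₀ v₀ →
      ∀ (d T S : ℕ) (Δ : ℝ), 1 ≤ d → 1 ≤ T → 1 ≤ S → 0 ≤ Δ →
      ∀ (U : Type*) [MeasurableSpace U] (A : BanditLB.RandomizedAlgorithm d U),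
        ((c * min (T : ℝ) (min ((d : ℝ) * Real.sqrt ((S : ℝ) * (T : ℝ)))
              ((d : ℝ) ^ (2 / 3 : ℝ) * Δ ^ (1 / 3 : ℝ) * (T : ℝ) ^ (2 / 3 : ℝ))) : ℝ) : EReal)
            ≤ BanditLB.dynRegret A F α β B T S Δ ∧
        ((d : ℝ) ^ 2 * min (S : ℝ) Δ ≤ (T : ℝ) →
          ((c * min ((d : ℝ) * Real.sqrt ((S : ℝ) * (T : ℝ)))
              ((d : ℝ) ^ (2 / 3 : ℝ) * Δ ^ (1 / 3 : ℝ) * (T : ℝ) ^ (2 / 3 : ℝ)) : ℝ) : EReal)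
            ≤ BanditLB.dynRegret A F α β B T S Δ) := by
  obtain ⟨c, hc, h⟩ := BanditLB.exists_le_dynRegret_of_blockLength hα hαβ hB hI₀ hv₀
  -- The factor `2` is lost in rounding the block length to an integer.
  refine ⟨c / 2, by positivity, fun F _ hF d T S Δ hd hT hS hΔ U _ A => ?_⟩
  have hmain : ((c / 2 * min (T : ℝ) (min ((d : ℝ) * Real.sqrt ((S : ℝ) * (T : ℝ)))
      ((d : ℝ) ^ (2 / 3 : ℝ) * Δ ^ (1 / 3 : ℝ) * (T : ℝ) ^ (2 / 3 : ℝ))) : ℝ) : EReal) ≤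
      BanditLB.dynRegret A F α β B T S Δ := by
    obtain ⟨n, hn, hnS, hnΔ, hM⟩ := BanditLB.exists_blockLength d T S Δ hd hT hS hΔ
    refine le_trans (EReal.coe_le_coe_iff.2 ?_) (h F hF d T S n Δ hd hT hn hnS hnΔ U A)
    calc _ ≤ c / 2 * (2 * (T * min 1 (d / √n))) := by gcongr
      _ = _ := by ring
  refine ⟨hmain, fun hT₀ => ?_⟩
  rwa [min_eq_right (BanditLB.min_le_of_sq_mul_min_le d T S hΔ hT₀)] at hmain
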